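/- Let $F$ be a finite field of characteristic $p$ and order $q=p^n$, so $n=[F:\mathbb{F}_p]$, and let $\psi\colon F\to\mathbb{C}$, $\psi(x)=e^{2\pi i\,\mathrm{Tr}(x)/p}$, be its canonical additive character, where $\mathrm{Tr}\colon F\to\mathbb{F}_p$ is the absolute trace. For a positive integer $d$ with $\gcd(d,q-1)=1$ and $a\in F$ put $$W_{F,d}(a)=\sum_{x\in F}\psi(x^d-ax)\in\mathbb{Q}(e^{2\pi i/p}),\qquad V_{F,d}=\min_{a\in F}\mathrm{val}_p\big(W_{F,d}(a)\big),$$ where $\mathrm{val}_p$ is the $p$-adic valuation of $\mathbb{Q}$ extended to $\mathbb{Q}(e^{2\pi i/p})$, so that $\mathrm{val}_p(p)=1$, $\mathrm{val}_p(1-e^{2\pi i/p})=1/(p-1)$ and $\mathrm{val}_p(0)=\infty$. Call $d$ degenerate over $F$ if $d\equiv p^k \pmod{q-1}$ for some integer $k\ge 0$, and nondegenerate over $F$ otherwise. Let $d$ be a positive integer with $\gcd(d,q-1)=1$. Then $V_{F,d}=[F:\mathbb{F}_p]$ if and only if $d$ is degenerate over $F$. If $d$ is nondegenerate over $F$, then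 $$\frac{2}{p-1}\le V_{F,d}<[F:\mathbb{F}_p],$$ and $V_{F,d}=\frac{2}{p-1}$ if and only if $-d\equiv p^k\pmod{q-1}$ for some integer $k\ge 0$. -/

import Mathlib

namespace BinomialWeil

open Complex

/-- The primitive `p`-th root of unity `exp(2πi/p)`. -/
noncomputable def zeta (p : ℕ) : ℂ := exp (2 * Real.pi * I / p)

/-- The cyclotomic field `ℚ(exp(2πi/p))` as a subfield of `ℂ`. -/
noncomputable abbrev cycField (p : ℕ) : IntermediateField ℚ ℂ :=
  IntermediateField.adjoin ℚ {zeta p}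

theorem zeta_mem (p : ℕ) : zeta p ∈ cycField p :=
  IntermediateField.mem_adjoin_simple_self ℚ (zeta p)

/-- `exp(2πi/p)` as an element of `ℚ(exp(2πi/p))`. -/
noncomputable def zetaK (p : ℕ) : cycField p := ⟨zeta p, zeta_mem p⟩

section Valuation

variable (p : ℕ) [hp : Fact p.Prime]

theorem zeta_isPrimitiveRoot : IsPrimitiveRoot (zeta p) p :=
  Complex.isPrimitiveRoot_exp p hp.out.ne_zero

theorem zetaK_isPrimitiveRoot : IsPrimitiveRoot (zetaK p) p :=
  IsPrimitiveRoot.of_map_of_injective (f := (cycField p).val) (zeta_isPrimitiveRoot p)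
    (cycField p).val.injective

instance cycField_isCyclotomicExtension : IsCyclotomicExtension {p} ℚ (cycField p) :=
  (IntermediateField.isCyclotomicExtension_singleton_iff_eq_adjoin p ℚ ℂ (cycField p)
    (zeta_isPrimitiveRoot p)).2 rfl

instance cycField_numberField : NumberField (cycField p) :=
  IsCyclotomicExtension.numberField {p} ℚ (cycField p)

/-- The prime ideal of the ring of integers of `ℚ(exp(2πi/p))` generated by
`exp(2πi/p) - 1`; it is the unique prime ideal above `p`. -/
noncomputable def primeAbove :
    IsDedekindDomain.HeightOneSpectrum (NumberField.RingOfIntegers (cycField p)) where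
  asIdeal := Ideal.span {(zetaK_isPrimitiveRoot p).toInteger - 1}
  isPrime := (Ideal.span_singleton_prime
    (zetaK_isPrimitiveRoot p).zeta_sub_one_prime'.ne_zero).2
      (zetaK_isPrimitiveRoot p).zeta_sub_one_prime'
  ne_bot := fun h => (zetaK_isPrimitiveRoot p).zeta_sub_one_prime'.ne_zero
    (Ideal.span_singleton_eq_bot.1 h)

/-- The `p`-adic valuation on `ℚ(exp(2πi/p))`, extending the one of `ℚ` and normalized by
`val (1 - exp(2πi/p)) = 1 / (p - 1)`, with `val 0 = ⊤`.  For `x ≠ 0`, minus the logarithm of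
`(primeAbove p).valuation x` is the exponent of the prime ideal in the factorization of `x`. -/
noncomputable def val (x : cycField p) : WithTop ℚ :=
  if x = 0 then ⊤
  else (((-(WithZero.log ((primeAbove p).valuation (cycField p) x)) : ℤ) : ℚ) / ((p : ℚ) - 1) : ℚ)

end Valuation

section WeilSum

variable (p : ℕ) [hp : Fact p.Prime] (F : Type*) [Field F] [Algebra (ZMod p) F]

/-- The canonical additive character `x ↦ exp(2πi Tr(x)/p)` of a finite field `F` of
characteristic `p`, where `Tr` is the absolute trace. -/
noncomputable def canonChar (x : F) : ℂ :=
  exp (2 * Real.pi * I * ((Algebra.trace (ZMod p) F x).val : ℂ) / p)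

theorem canonChar_mem (x : F) : canonChar p F x ∈ cycField p := by
  have h : canonChar p F x = zeta p ^ (Algebra.trace (ZMod p) F x).val := by
    rw [canonChar, zeta, ← Complex.exp_nat_mul]
    congr 1
    ring
  rw [h]
  exact pow_mem (zeta_mem p) _

variable [Fintype F]

/-- The Weil sum `W_{F,d}(a) = ∑_{x ∈ F} ψ(x^d - a x)`. -/
noncomputable def weilSum (d : ℕ) (a : F) : ℂ := ∑ x : F, canonChar p F (x ^ d - a * x)

theorem weilSum_mem (d : ℕ) (a : F) : weilSum p F d a ∈ cycField p :=
  sum_mem fun _ _ => canonChar_mem p F _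

/-- `V_{F,d}`, the minimum over `a ∈ F` of the `p`-adic valuation of `W_{F,d}(a)`. -/
noncomputable def minVal (d : ℕ) : WithTop ℚ :=
  Finset.univ.inf' Finset.univ_nonempty
    fun a : F => val p ⟨weilSum p F d a, weilSum_mem p F d a⟩

/-- `d` is degenerate over `F`: it is congruent to a power of `p` modulo `|F| - 1`. -/
def Degenerate (d : ℕ) : Prop := ∃ k : ℕ, d ≡ p ^ k [MOD Fintype.card F - 1]

end WeilSum

end BinomialWeil

/-!
The proof works with the prime element `π = ζ - 1` of the ring of integers of `ℚ(ζ)`, for which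
`|F| = p ^ n` is associated to `π ^ (n (p - 1))`; all claims become divisibilities of the Weil sums
`W(a)` by powers of `π` (`le_minVal_iff`, `minVal_eq_iff`). No Gauss sums are needed.

*Upper bound.* If `|F|` divides every `W(a)`, then each `W(a) / |F|` is an algebraic integer whose
conjugates have absolute value at most one, hence is zero or a root of unity by Kronecker's
theorem. Since `∑ W(a) = |F|`, some `W(a)` has absolute value `|F|`, and equality in the triangle
inequality gives `Tr (x ^ d) = Tr (a x)` for all `x`. Power sums over `F` then show that `d` is
degenerate (`degenerate_of_forall_card_dvd`, `degenerate_of_trace_pow_eq`).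

*Lower bound.* Since `x ↦ x ^ d` permutes `F`, modulo `|F|` the sum `W(a)` equals
`∑ (ψ (x ^ d) - 1) (ψ (-a x) - 1)`. As `ψ y - 1 ≡ π Tr y` modulo `π ^ 2`, this is
`π ^ 2 ∑ Tr (x ^ d) Tr (-a x)` modulo `π ^ 3` (`exists_charSum_eq`), and for nondegenerate `d` the
modulus `|F|` is itself divisible by `π ^ 3` (`three_le_of_not_degenerate`). So `π ^ 2` always
divides `W(a)`, and `π ^ 3` divides all of them exactly when `∑ x Tr (x ^ d) = 0`. That sum is minus
the number of `i < n` with `d p ^ i ≡ -1`, which is zero or one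
(`forall_sum_trace_mul_trace_eq_zero_iff`).
-/

/-! ### Power sums and traces over a finite field -/

namespace BinomialWeil

section PowerSums

variable (F : Type*) [Field F] [Fintype F]

theorem sum_pow_of_pos {i : ℕ} (hi : 0 < i) :
    ∑ x : F, x ^ i = if Fintype.card F - 1 ∣ i then -1 else 0 := by
  classical
  rw [← FiniteField.sum_pow_units F i, ← Fintype.sum_subtype_add_sum_subtype (fun x : F => x = 0)]
  rw [Finset.sum_eq_zero fun x _ => by rw [x.2, zero_pow hi.ne'], zero_add]
  exact (Fintype.sum_equiv unitsEquivNeZero _ _ fun _ => rfl).symm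

variable {F}

theorem pow_eq_pow_of_modEq {i j : ℕ} (hi : 0 < i) (hj : 0 < j)
    (h : i ≡ j [MOD Fintype.card F - 1]) (x : F) : x ^ i = x ^ j := by
  rcases eq_or_ne x 0 with rfl | hx
  · rw [zero_pow hi.ne', zero_pow hj.ne']
  · lift x to Fˣ using hx.isUnit
    have hx1 : x ^ (Fintype.card F - 1) = 1 :=
      Units.ext (by simpa using FiniteField.pow_card_sub_one_eq_one (x : F) hx)
    exact_mod_cast congrArg Units.val
      (pow_eq_pow_iff_modEq.2 (h.of_dvd (orderOf_dvd_of_pow_eq_one hx1)))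

theorem pow_bijective_of_coprime {d : ℕ} (hd : 0 < d)
    (hcop : d.gcd (Fintype.card F - 1) = 1) : Function.Bijective fun x : F => x ^ d := by
  refine Finite.injective_iff_bijective.1 fun x y (h : x ^ d = y ^ d) => ?_
  rcases eq_or_ne y 0 with rfl | hy
  · rw [zero_pow hd.ne'] at h
    exact eq_zero_of_pow_eq_zero h
  have h1 : (x / y) ^ d = 1 := by rw [div_pow, h, div_self (pow_ne_zero _ hy)]
  have hx : x ≠ 0 := by
    rintro rfl
    rw [zero_pow hd.ne'] at h
    exact pow_ne_zero _ hy h.symm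
  have h2 := pow_gcd_eq_one.2 ⟨h1, FiniteField.pow_card_sub_one_eq_one _ (div_ne_zero hx hy)⟩
  rw [hcop, pow_one] at h2
  exact (div_eq_one_iff_eq hy).1 h2

end PowerSums

section Exponents

variable (p : ℕ) [hp : Fact p.Prime] (F : Type*) [Field F] [Fintype F] [Algebra (ZMod p) F]

theorem card_eq_pow : Fintype.card F = p ^ Module.finrank (ZMod p) F := by
  rw [Module.card_eq_pow_finrank (K := ZMod p), ZMod.card]

theorem finrank_pos : 0 < Module.finrank (ZMod p) F := Module.finrank_pos

theorem two_le_card : 2 ≤ Fintype.card F := Fintype.one_lt_card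

theorem pow_finrank_modEq : p ^ Module.finrank (ZMod p) F ≡ 1 [MOD Fintype.card F - 1] := by
  rw [← card_eq_pow p F]
  exact ((Nat.modEq_iff_dvd' (by have := two_le_card F; omega)).2 dvd_rfl).symm

theorem coprime_card_sub_one : (Fintype.card F - 1).Coprime p := by
  have h := two_le_card F
  have hdvd : p ∣ Fintype.card F := by
    rw [card_eq_pow p F]
    exact dvd_pow_self _ (finrank_pos p F).ne'
  refine Nat.Coprime.coprime_dvd_right hdvd ?_
  exact (Nat.coprime_self_sub_left (by omega)).2 (Nat.coprime_one_left _)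

/-- The powers `p ^ i` with `i < n` are pairwise incongruent modulo `p ^ n - 1`. -/
theorem eq_of_pow_modEq {i j : ℕ} (hi : i < Module.finrank (ZMod p) F)
    (hj : j < Module.finrank (ZMod p) F)
    (h : p ^ i ≡ p ^ j [MOD Fintype.card F - 1]) : i = j := by
  wlog hij : i ≤ j generalizing i j
  · exact (this hj hi h.symm (by omega)).symm
  obtain ⟨k, rfl⟩ := Nat.exists_eq_add_of_le hij
  rw [pow_add] at h
  have h1 : 1 ≡ p ^ k [MOD Fintype.card F - 1] :=
    Nat.ModEq.cancel_left_of_coprime (c := p ^ i)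
      ((coprime_card_sub_one p F).pow_right i) (by simpa using h)
  have hpk : 1 ≤ p ^ k := Nat.one_le_pow _ _ hp.out.pos
  have h2 : Fintype.card F - 1 ∣ p ^ k - 1 := (Nat.modEq_iff_dvd' hpk).1 h1
  have h3 : p ^ k < Fintype.card F := by
    rw [card_eq_pow p F]
    exact Nat.pow_lt_pow_right hp.out.one_lt (by omega)
  have h4 : p ^ k - 1 = 0 := Nat.eq_zero_of_dvd_of_lt h2 (by omega)
  have h5 : p ^ k = 1 := by omega
  have : k = 0 := by
    by_contra hk
    exact (Nat.one_lt_pow hk hp.out.one_lt).ne' h5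
  omega

/-- An exponent `k` with `-d ≡ p ^ k` is traded for an exponent `i < n` with `d p ^ i ≡ -1`. -/
theorem exists_neg_modEq_pow_iff (d : ℕ) :
    (∃ k : ℕ, -(d : ℤ) ≡ (p : ℤ) ^ k [ZMOD (Fintype.card F : ℤ) - 1]) ↔
      ∃ i < Module.finrank (ZMod p) F, Fintype.card F - 1 ∣ 1 + d * p ^ i := by
  set n := Module.finrank (ZMod p) F with hn
  have hn0 : 0 < n := finrank_pos p F
  have hcast : ((Fintype.card F - 1 : ℕ) : ℤ) = (Fintype.card F : ℤ) - 1 := by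
    have := two_le_card F
    push_cast [Nat.cast_sub (show 1 ≤ Fintype.card F by omega)]
    rfl
  have hpn : (p : ℤ) ^ n ≡ 1 [ZMOD (Fintype.card F : ℤ) - 1] := by
    rw [← hcast]
    exact_mod_cast (Int.natCast_modEq_iff.2 (pow_finrank_modEq p F))
  have key (i : ℕ) : Fintype.card F - 1 ∣ 1 + d * p ^ i ↔
      -(d : ℤ) * p ^ i ≡ 1 [ZMOD (Fintype.card F : ℤ) - 1] := by
    rw [← Int.natCast_dvd_natCast, hcast, Int.modEq_iff_dvd]
    push_cast
    rw [neg_mul, sub_neg_eq_add]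
  constructor
  · rintro ⟨k, hk⟩
    -- Any representative of `-k` modulo `n` will do, as `p ^ n ≡ 1`.
    refine ⟨(n * k - k) % n, Nat.mod_lt _ hn0, (key _).2 ?_⟩
    have h1 : (p : ℤ) ^ (n * k - k) ≡ p ^ ((n * k - k) % n) [ZMOD (Fintype.card F : ℤ) - 1] := by
      conv_lhs => rw [← Nat.div_add_mod (n * k - k) n, pow_add, pow_mul]
      simpa using (hpn.pow ((n * k - k) / n)).mul_right _
    refine ((h1.mul_left _).symm.trans (hk.mul_right _)).trans ?_
    have h2 : k + (n * k - k) = n * k := by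
      have := Nat.le_mul_of_pos_left k hn0
      omega
    rw [← pow_add, h2, pow_mul]
    simpa using hpn.pow k
  · rintro ⟨i, hi, h⟩
    refine ⟨n - i, ?_⟩
    have h1 := ((key i).1 h).mul_right ((p : ℤ) ^ (n - i))
    rw [mul_assoc, ← pow_add, Nat.add_sub_cancel' hi.le, one_mul] at h1
    have h2 := hpn.mul_left (-(d : ℤ))
    rw [mul_one] at h2
    exact h2.symm.trans h1

/-- The finitely many fields with `n (p - 1) ≤ 2`, namely those of order 2, 3 and 4, have only
degenerate exponents. -/
theorem three_le_of_not_degenerate {d : ℕ} (hcop : d.gcd (Fintype.card F - 1) = 1)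
    (hnd : ¬ Degenerate p F d) : 3 ≤ Module.finrank (ZMod p) F * (p - 1) := by
  by_contra hlt
  have hn0 := finrank_pos p F
  have hp2 := hp.out.two_le
  have hcard := card_eq_pow p F
  rw [Degenerate] at hnd
  generalize Module.finrank (ZMod p) F = n at *
  have hn2 : n ≤ 2 := by nlinarith [Nat.sub_add_cancel (show 1 ≤ p by omega)]
  have hp3 : p ≤ 3 := by
    have : p - 1 ≤ n * (p - 1) := Nat.le_mul_of_pos_left _ hn0
    omega
  interval_cases n <;> interval_cases p <;> norm_num at hcard hlt <;> rw [hcard] at hnd hcop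
  · exact hnd ⟨0, Nat.modEq_one⟩
  · refine hnd ⟨0, ?_⟩
    exact Nat.odd_iff.1 (Nat.coprime_two_right.1 hcop)
  · have h3 : ¬ 3 ∣ d := fun h => by
      have := Nat.gcd_eq_right h
      norm_num at hcop
      omega
    have : d % 3 = 1 ∨ d % 3 = 2 := by omega
    rcases this with h | h
    · exact hnd ⟨0, h⟩
    · exact hnd ⟨1, h⟩

end Exponents

section Trace

variable (p : ℕ) [hp : Fact p.Prime] (F : Type*) [Field F] [Fintype F] [Algebra (ZMod p) F]

theorem algebraMap_trace (x : F) : algebraMap (ZMod p) F (Algebra.trace (ZMod p) F x) =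
    ∑ i ∈ Finset.range (Module.finrank (ZMod p) F), x ^ p ^ i := by
  rw [FiniteField.algebraMap_trace_eq_sum_pow, Nat.card_zmod]

theorem trace_pow_pow (x : F) (k : ℕ) :
    Algebra.trace (ZMod p) F (x ^ p ^ k) = Algebra.trace (ZMod p) F x := by
  have h := Algebra.trace_eq_of_algEquiv (FiniteField.frobeniusAlgEquivOfAlgebraic (ZMod p) F ^ k) x
  rwa [AlgEquiv.coe_pow, FiniteField.coe_frobeniusAlgEquivOfAlgebraic_iterate, ZMod.card] at h

/-- A power map that agrees, under the trace, with a linear form has a degenerate exponent: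
otherwise pairing both sides with `x ^ (-d)` gives `-1` on the left and `0` on the right. -/
theorem degenerate_of_trace_pow_eq {d : ℕ} (hd : 0 < d)
    (hcop : d.gcd (Fintype.card F - 1) = 1) (a : F)
    (h : ∀ x : F, Algebra.trace (ZMod p) F (x ^ d) = Algebra.trace (ZMod p) F (a * x)) :
    Degenerate p F d := by
  by_contra hnd
  set n := Module.finrank (ZMod p) F
  set Q := Fintype.card F - 1
  have hn0 : 0 < n := finrank_pos p F
  have hQ : 0 < Q := by have := two_le_card F; omega
  -- The exponent `d * (2 * Q - 1)` is positive and represents `-d` modulo `Q`.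
  have hpair : ∑ x : F, (∑ i ∈ Finset.range n, (x ^ d) ^ p ^ i) * x ^ (d * (2 * Q - 1)) =
      ∑ x : F, (∑ i ∈ Finset.range n, (a * x) ^ p ^ i) * x ^ (d * (2 * Q - 1)) :=
    Finset.sum_congr rfl fun x _ => by rw [← algebraMap_trace, ← algebraMap_trace, h]
  have hL : ∑ x : F, (∑ i ∈ Finset.range n, (x ^ d) ^ p ^ i) * x ^ (d * (2 * Q - 1)) = -1 := by
    simp_rw [Finset.sum_mul]
    rw [Finset.sum_comm, Finset.sum_eq_single 0]
    · simp_rw [pow_zero, pow_one, ← pow_add]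
      rw [sum_pow_of_pos F (by omega), if_pos]
      refine ⟨d * 2, ?_⟩
      zify [show 1 ≤ 2 * Q by omega]
      ring
    · intro i hi hi0
      simp_rw [← pow_mul, ← pow_add]
      rw [sum_pow_of_pos F (by have := hp.out.pos; positivity), if_neg]
      intro hdvd
      rw [← mul_add] at hdvd
      have h1 : Q ∣ p ^ i + (2 * Q - 1) :=
        Nat.Coprime.dvd_of_dvd_mul_left (Nat.Coprime.symm hcop) hdvd
      have h2 : p ^ i ≡ p ^ 0 [MOD Q] := by
        have hpi : 1 ≤ p ^ i := Nat.one_le_pow _ _ hp.out.pos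
        refine ((Nat.modEq_iff_dvd' (by simpa using hpi)).2 ?_).symm
        have h3 : p ^ i + (2 * Q - 1) = (p ^ i - p ^ 0) + Q * 2 := by simp; omega
        rw [h3] at h1
        exact (Nat.dvd_add_left (dvd_mul_right _ _)).1 h1
      exact hi0 (eq_of_pow_modEq p F (Finset.mem_range.1 hi) hn0 h2)
    · intro h0
      exact absurd (Finset.mem_range.2 hn0) h0
  have hR : ∑ x : F, (∑ i ∈ Finset.range n, (a * x) ^ p ^ i) * x ^ (d * (2 * Q - 1)) = 0 := by
    simp_rw [Finset.sum_mul]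
    rw [Finset.sum_comm]
    refine Finset.sum_eq_zero fun i _ => ?_
    simp_rw [mul_pow, mul_assoc, ← pow_add]
    rw [← Finset.mul_sum, sum_pow_of_pos F (by have := hp.out.pos; positivity), if_neg, mul_zero]
    intro hdvd
    refine hnd ⟨i, ?_⟩
    have h1 : p ^ i + d * (2 * Q - 1) ≡ 0 [MOD Q] := (Nat.modEq_zero_iff_dvd).2 hdvd
    have h2 : d + d * (2 * Q - 1) ≡ 0 [MOD Q] := by
      refine Nat.modEq_zero_iff_dvd.2 ⟨d * 2, ?_⟩
      zify [show 1 ≤ 2 * Q by omega]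
      ring
    exact Nat.ModEq.add_right_cancel' _ (h2.trans h1.symm)
  rw [hL, hR] at hpair
  exact one_ne_zero (neg_eq_zero.1 hpair)

/-- The sum is minus the number of `i < n` with `d p ^ i ≡ -1`; there is at most one such `i`, so
this number does not vanish modulo `p` unless it is zero. -/
theorem sum_mul_trace_pow_eq_zero_iff {d : ℕ} (hcop : d.gcd (Fintype.card F - 1) = 1) :
    ∑ x : F, x * algebraMap (ZMod p) F (Algebra.trace (ZMod p) F (x ^ d)) = 0 ↔
      ¬ ∃ i < Module.finrank (ZMod p) F, Fintype.card F - 1 ∣ 1 + d * p ^ i := by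
  have hsum : ∑ x : F, x * algebraMap (ZMod p) F (Algebra.trace (ZMod p) F (x ^ d)) =
      ∑ i ∈ Finset.range (Module.finrank (ZMod p) F),
        if Fintype.card F - 1 ∣ 1 + d * p ^ i then -1 else 0 := by
    simp_rw [algebraMap_trace, Finset.mul_sum]
    rw [Finset.sum_comm]
    refine Finset.sum_congr rfl fun i _ => ?_
    rw [← sum_pow_of_pos F (by omega)]
    exact Finset.sum_congr rfl fun x _ => by rw [pow_add, pow_one, pow_mul]
  rw [hsum]
  constructor
  · rintro h ⟨i, hi, hdvd⟩
    rw [Finset.sum_eq_single i, if_pos hdvd] at h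
    · exact one_ne_zero (neg_eq_zero.1 h)
    · intro j hj hji
      refine if_neg fun hdvd' => hji (eq_of_pow_modEq p F (Finset.mem_range.1 hj) hi ?_)
      have h1 : 1 + d * p ^ j ≡ 1 + d * p ^ i [MOD Fintype.card F - 1] :=
        (Nat.modEq_zero_iff_dvd.2 hdvd').trans (Nat.modEq_zero_iff_dvd.2 hdvd).symm
      exact Nat.ModEq.cancel_left_of_coprime (by rwa [Nat.gcd_comm])
        (Nat.ModEq.add_left_cancel' _ h1)
    · exact fun h0 => absurd (Finset.mem_range.2 hi) h0
  · intro h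
    exact Finset.sum_eq_zero fun i hi => if_neg fun hdvd => h ⟨i, Finset.mem_range.1 hi, hdvd⟩

theorem sum_trace_mul_trace (d : ℕ) (a : F) :
    ∑ x : F, Algebra.trace (ZMod p) F (x ^ d) * Algebra.trace (ZMod p) F (a * x) =
      Algebra.trace (ZMod p) F
        (a * ∑ x : F, x * algebraMap (ZMod p) F (Algebra.trace (ZMod p) F (x ^ d))) := by
  rw [Finset.mul_sum, map_sum]
  refine Finset.sum_congr rfl fun x _ => ?_
  rw [← smul_eq_mul, ← map_smul, Algebra.smul_def]
  congr 1
  ring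

/-- By nondegeneracy of the trace form, the pairing vanishes for all `a` exactly when
`∑ x Tr (x ^ d)` does. -/
theorem forall_sum_trace_mul_trace_eq_zero_iff {d : ℕ}
    (hcop : d.gcd (Fintype.card F - 1) = 1) :
    (∀ a : F, ∑ x : F, Algebra.trace (ZMod p) F (x ^ d) * Algebra.trace (ZMod p) F (a * x) = 0) ↔
      ¬ ∃ k : ℕ, -(d : ℤ) ≡ (p : ℤ) ^ k [ZMOD (Fintype.card F : ℤ) - 1] := by
  rw [exists_neg_modEq_pow_iff, ← sum_mul_trace_pow_eq_zero_iff p F hcop]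
  simp_rw [sum_trace_mul_trace]
  refine ⟨fun h => ?_, fun h a => by rw [h, mul_zero, map_zero]⟩
  by_contra hs
  obtain ⟨y, hy⟩ := Algebra.trace_surjective (ZMod p) F 1
  have := h (y * (∑ x : F, x * algebraMap (ZMod p) F (Algebra.trace (ZMod p) F (x ^ d)))⁻¹)
  rw [inv_mul_cancel_right₀ hs, hy] at this
  exact one_ne_zero this

end Trace

end BinomialWeil

/-! ### Additive characters attached to a root of unity -/

namespace BinomialWeil

section TraceChar

variable (p : ℕ) [hp : Fact p.Prime] (F : Type*) [Field F] [Algebra (ZMod p) F]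
  {R : Type*} [CommRing R]

/-- The additive character `x ↦ η ^ Tr x` of `F` attached to a `p`-th root of unity `η` of an
arbitrary commutative ring. Keeping the ring arbitrary gives the canonical character with values
in the ring of integers and all its complex conjugates at once. -/
noncomputable def traceChar {η : R} (hη : η ^ p = 1) : AddChar F R :=
  (AddChar.zmodChar p hη).compAddMonoidHom (Algebra.trace (ZMod p) F).toAddMonoidHom

theorem traceChar_apply {η : R} (hη : η ^ p = 1) (x : F) :
    traceChar p F hη x = η ^ (Algebra.trace (ZMod p) F x).val := rfl

variable [Fintype F]

theorem traceChar_isPrimitive {η : R} (hη : IsPrimitiveRoot η p) :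
    (traceChar p F hη.pow_eq_one).IsPrimitive := by
  refine AddChar.IsPrimitive.of_ne_one fun h => ?_
  obtain ⟨y, hy⟩ := Algebra.trace_surjective (ZMod p) F 1
  have h1 := DFunLike.congr_fun h y
  rw [traceChar_apply, hy, AddChar.one_apply, ZMod.val_one, pow_one] at h1
  exact hp.out.one_lt.ne' (hη.eq_orderOf.trans (by rw [h1, orderOf_one]))

/-- The Weil sum `∑ χ (x ^ d - a x)` for the character `χ` attached to `η`. -/
noncomputable def charSum {η : R} (hη : η ^ p = 1) (d : ℕ) (a : F) : R :=
  ∑ x : F, traceChar p F hη (x ^ d - a * x)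

theorem charSum_eq_sum_mul {η : R} (hη : η ^ p = 1) (d : ℕ) (a : F) :
    charSum p F hη d a =
      ∑ x : F, traceChar p F hη (x ^ d) * traceChar p F hη (-a * x) :=
  Finset.sum_congr rfl fun x _ => by rw [sub_eq_add_neg, ← neg_mul, AddChar.map_add_eq_mul]

theorem map_charSum {S : Type*} [CommRing S] (f : R →+* S) {η : R} (hη : η ^ p = 1)
    {η' : S} (hη' : η' ^ p = 1) (h : f η = η') (d : ℕ) (a : F) :
    f (charSum p F hη d a) = charSum p F hη' d a := by
  subst h
  simp [charSum, traceChar_apply]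

variable [IsDomain R]

theorem sum_traceChar_mul {η : R} (hη : IsPrimitiveRoot η p) [DecidableEq F] (b : F) :
    ∑ x : F, traceChar p F hη.pow_eq_one (b * x) = if b = 0 then (Fintype.card F : R) else 0 := by
  have h := AddChar.sum_mulShift b (traceChar_isPrimitive p F hη)
  rw [Nat.cast_ite, Nat.cast_zero] at h
  rw [← h]
  exact Finset.sum_congr rfl fun x _ => by rw [mul_comm]

theorem sum_traceChar_pow {η : R} (hη : IsPrimitiveRoot η p) {d : ℕ} (hd : 0 < d)
    (hcop : d.gcd (Fintype.card F - 1) = 1) :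
    ∑ x : F, traceChar p F hη.pow_eq_one (x ^ d) = 0 := by
  classical
  rw [(pow_bijective_of_coprime hd hcop).sum_comp (traceChar p F hη.pow_eq_one)]
  simpa using sum_traceChar_mul p F hη 1

/-- Summing over the linear coefficient leaves only the contribution of `x = 0`. -/
theorem sum_charSum {η : R} (hη : IsPrimitiveRoot η p) {d : ℕ} (hd : 0 < d) :
    ∑ a : F, charSum p F hη.pow_eq_one d a = Fintype.card F := by
  classical
  simp_rw [charSum_eq_sum_mul]
  rw [Finset.sum_comm, Finset.sum_eq_single 0]
  · simp [zero_pow hd.ne']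
  · intro x _ hx
    have h := sum_traceChar_mul p F hη (-x)
    rw [if_neg (neg_ne_zero.2 hx)] at h
    rw [← Finset.mul_sum]
    simp_rw [neg_mul, mul_comm _ x, ← neg_mul]
    rw [h, mul_zero]
  · exact fun h => absurd (Finset.mem_univ _) h

/-- Both one-variable sums are known, so the Weil sum is, modulo `|F|`, the sum of the products
`(χ (x ^ d) - 1) (χ (-a x) - 1)`, in which each factor is divisible by `η - 1`. -/
theorem card_dvd_charSum_sub {η : R} (hη : IsPrimitiveRoot η p) {d : ℕ} (hd : 0 < d)
    (hcop : d.gcd (Fintype.card F - 1) = 1) (a : F) :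
    (Fintype.card F : R) ∣ charSum p F hη.pow_eq_one d a -
      ∑ x : F, (traceChar p F hη.pow_eq_one (x ^ d) - 1) *
        (traceChar p F hη.pow_eq_one (-a * x) - 1) := by
  classical
  have h1 := sum_traceChar_pow p F hη hd hcop
  have h2 := sum_traceChar_mul p F hη (-a)
  have h3 : charSum p F hη.pow_eq_one d a -
      ∑ x : F, (traceChar p F hη.pow_eq_one (x ^ d) - 1) *
        (traceChar p F hη.pow_eq_one (-a * x) - 1) =
      ∑ x : F, traceChar p F hη.pow_eq_one (x ^ d) +
        ∑ x : F, traceChar p F hη.pow_eq_one (-a * x) - Fintype.card F := by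
    rw [charSum_eq_sum_mul, ← Finset.sum_sub_distrib, ← Finset.sum_add_distrib, ← Finset.card_univ,
      ← nsmul_one, ← Finset.sum_const, ← Finset.sum_sub_distrib]
    exact Finset.sum_congr rfl fun x _ => by ring
  rw [h3, h1, h2]
  split_ifs <;> simp

omit [Fintype F] [IsDomain R] in
theorem exists_traceChar_sub_one_eq {η : R} (hη : η ^ p = 1) (x : F) :
    ∃ c : R, traceChar p F hη x - 1 =
      (η - 1) * ((Algebra.trace (ZMod p) F x).val + (η - 1) * c) := by
  rw [traceChar_apply]
  generalize (Algebra.trace (ZMod p) F x).val = t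
  induction t with
  | zero => exact ⟨0, by simp⟩
  | succ t ih =>
    obtain ⟨c, hc⟩ := ih
    refine ⟨t + c + (η - 1) * c, ?_⟩
    rw [pow_succ, eq_add_of_sub_eq hc]
    push_cast
    ring

/-- The leading term of the Weil sum in powers of `η - 1`: modulo `|F|` and `(η - 1) ^ 3` it is
`(η - 1) ^ 2` times an integer representing `∑ Tr (x ^ d) Tr (-a x)`. -/
theorem exists_charSum_eq {η : R} (hη : IsPrimitiveRoot η p) {d : ℕ} (hd : 0 < d)
    (hcop : d.gcd (Fintype.card F - 1) = 1) (a : F) :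
    ∃ (T : ℕ) (c e : R), (T : ZMod p) =
        ∑ x : F, Algebra.trace (ZMod p) F (x ^ d) * Algebra.trace (ZMod p) F (-a * x) ∧
      charSum p F hη.pow_eq_one d a =
        (η - 1) ^ 2 * (T + (η - 1) * c) + Fintype.card F * e := by
  obtain ⟨e, he⟩ := card_dvd_charSum_sub p F hη hd hcop a
  choose c hc using exists_traceChar_sub_one_eq p F hη.pow_eq_one
  refine ⟨∑ x : F, (Algebra.trace (ZMod p) F (x ^ d)).val *
      (Algebra.trace (ZMod p) F (-a * x)).val,
    ∑ x : F, ((Algebra.trace (ZMod p) F (x ^ d)).val * c (-a * x) +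
      c (x ^ d) * (Algebra.trace (ZMod p) F (-a * x)).val +
      (η - 1) * (c (x ^ d) * c (-a * x))), e, ?_, ?_⟩
  · simp
  · rw [eq_add_of_sub_eq he, add_comm]
    congr 1
    push_cast
    rw [Finset.mul_sum, ← Finset.sum_add_distrib, Finset.mul_sum]
    refine Finset.sum_congr rfl fun x _ => ?_
    rw [hc, hc]
    ring

end TraceChar

section Degenerate

variable (p : ℕ) [hp : Fact p.Prime] (F : Type*) [Field F] [Fintype F] [Algebra (ZMod p) F]

theorem charSum_of_degenerate {R : Type*} [CommRing R] [IsDomain R] {η : R}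
    (hη : IsPrimitiveRoot η p) {d : ℕ} (hd : 0 < d) (hdeg : Degenerate p F d)
    [DecidableEq F] (a : F) :
    charSum p F hη.pow_eq_one d a = if a = 1 then (Fintype.card F : R) else 0 := by
  obtain ⟨k, hk⟩ := hdeg
  have h : charSum p F hη.pow_eq_one d a =
      ∑ x : F, traceChar p F hη.pow_eq_one ((1 - a) * x) := by
    refine Finset.sum_congr rfl fun x _ => ?_
    rw [traceChar_apply, traceChar_apply,
      pow_eq_pow_of_modEq hd (pow_pos hp.out.pos k) hk, map_sub, trace_pow_pow, ← map_sub,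
      sub_mul, one_mul]
  rw [h, sum_traceChar_mul p F hη]
  simp only [sub_eq_zero, eq_comm (a := (1 : F))]

omit [Fintype F] in
theorem norm_traceChar {η : ℂ} (hη : η ^ p = 1) (x : F) : ‖traceChar p F hη x‖ = 1 := by
  rw [traceChar_apply, norm_pow, Complex.norm_eq_one_of_pow_eq_one hη hp.out.ne_zero, one_pow]

theorem norm_charSum_le {η : ℂ} (hη : η ^ p = 1) (d : ℕ) (a : F) :
    ‖charSum p F hη d a‖ ≤ Fintype.card F := by
  refine (norm_sum_le _ _).trans ?_
  simp

/-- Equality in the triangle inequality forces all terms to coincide with the term at `0`. -/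
theorem traceChar_eq_one_of_norm_charSum {η : ℂ} (hη : η ^ p = 1) {d : ℕ} (hd : 0 < d) {a : F}
    (h : ‖charSum p F hη d a‖ = Fintype.card F) (x : F) :
    traceChar p F hη (x ^ d - a * x) = 1 := by
  have h0 : traceChar p F hη ((0 : F) ^ d - a * 0) = 1 := by
    rw [zero_pow hd.ne', mul_zero, sub_zero, AddChar.map_zero_eq_one]
  by_contra hx
  have hq : (0 : ℝ) < Fintype.card F := by exact_mod_cast Fintype.card_pos
  have hlt := norm_sum_lt_of_strictConvexSpace (t := Finset.univ) (r := 1)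
    (w := fun _ : F => (Fintype.card F : ℝ)⁻¹)
    (z := fun x : F => traceChar p F hη (x ^ d - a * x)) (fun _ _ => (inv_pos.2 hq).le)
    (by simp [hq.ne']) (Finset.mem_univ x) (Finset.mem_univ 0) (by rwa [h0])
    (inv_pos.2 hq).ne' (inv_pos.2 hq).ne' (fun y _ => (norm_traceChar p F hη _).le)
  rw [← Finset.smul_sum, norm_smul, norm_inv, Real.norm_natCast] at hlt
  change _ * ‖charSum p F hη d a‖ < 1 at hlt
  rw [h, inv_mul_cancel₀ hq.ne'] at hlt
  exact lt_irrefl _ hlt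

theorem degenerate_of_norm_charSum {η : ℂ} (hη : IsPrimitiveRoot η p) {d : ℕ} (hd : 0 < d)
    (hcop : d.gcd (Fintype.card F - 1) = 1) {a : F}
    (h : ‖charSum p F hη.pow_eq_one d a‖ = Fintype.card F) : Degenerate p F d := by
  refine degenerate_of_trace_pow_eq p F hd hcop a fun x => ?_
  have h1 := traceChar_eq_one_of_norm_charSum p F hη.pow_eq_one hd h x
  rw [traceChar_apply, hη.pow_eq_one_iff_dvd] at h1
  have h2 := Nat.eq_zero_of_dvd_of_lt h1 (ZMod.val_lt _)
  rwa [ZMod.val_eq_zero, map_sub, sub_eq_zero] at h2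

end Degenerate

end BinomialWeil

/-! ### Valuations of the Weil sums -/

namespace BinomialWeil

open NumberField

section Val

variable (p : ℕ) [hp : Fact p.Prime]

/-- The primitive `p`-th root of unity `exp(2πi/p)` as an algebraic integer. -/
noncomputable abbrev zetaInt : 𝓞 (cycField p) := (zetaK_isPrimitiveRoot p).toInteger

theorem zetaInt_isPrimitiveRoot : IsPrimitiveRoot (zetaInt p) p :=
  (zetaK_isPrimitiveRoot p).toInteger_isPrimitiveRoot

theorem natCast_sub_one_pos : (0 : ℚ) < (p : ℚ) - 1 := by
  have : (1 : ℚ) < p := by exact_mod_cast hp.out.one_lt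
  linarith

theorem le_val_iff (m : ℕ) (w : 𝓞 (cycField p)) :
    (((m : ℚ) / ((p : ℚ) - 1) : ℚ) : WithTop ℚ) ≤ val p (w : cycField p) ↔
      (zetaInt p - 1) ^ m ∣ w := by
  rcases eq_or_ne w 0 with rfl | hw
  · simp [val]
  have hw' : (w : cycField p) ≠ 0 := by simpa using hw
  have h := (primeAbove p).intValuation_le_pow_iff_mem w m
  have hpow : (primeAbove p).asIdeal ^ m = Ideal.span {(zetaInt p - 1) ^ m} :=
    Ideal.span_singleton_pow _ _
  rw [hpow, Ideal.mem_span_singleton,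
    ← WithZero.log_le_iff_le_exp ((primeAbove p).intValuation_ne_zero w hw)] at h
  rw [val, if_neg hw', WithTop.coe_le_coe, div_le_div_iff_of_pos_right (natCast_sub_one_pos p),
    IsDedekindDomain.HeightOneSpectrum.valuation_of_algebraMap, ← h]
  rw [← Int.cast_natCast, Int.cast_le]
  omega

/-- The valuation takes values in `(p - 1)⁻¹ ℤ`, so it is pinned by two consecutive bounds. -/
theorem val_eq_iff (m : ℕ) (x : cycField p) :
    val p x = (((m : ℚ) / ((p : ℚ) - 1) : ℚ) : WithTop ℚ) ↔
      (((m : ℚ) / ((p : ℚ) - 1) : ℚ) : WithTop ℚ) ≤ val p x ∧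
      ¬ ((((m + 1 : ℕ) : ℚ) / ((p : ℚ) - 1) : ℚ) : WithTop ℚ) ≤ val p x := by
  have hpos := natCast_sub_one_pos p
  rcases eq_or_ne x 0 with rfl | hx
  · simp [val]
  · rw [val, if_neg hx, WithTop.coe_le_coe, WithTop.coe_le_coe, WithTop.coe_inj,
      div_le_div_iff_of_pos_right hpos, div_le_div_iff_of_pos_right hpos, div_left_inj' hpos.ne',
      ← Int.cast_natCast m, ← Int.cast_natCast (m + 1), Int.cast_le, Int.cast_le, Int.cast_inj]
    omega

theorem associated_pow_natCast_pow (n : ℕ) :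
    Associated ((zetaInt p - 1) ^ (n * (p - 1))) ((p ^ n : ℕ) : 𝓞 (cycField p)) := by
  rw [mul_comm, pow_mul, Nat.cast_pow]
  exact (IsCyclotomicExtension.Rat.associated_zeta_sub_one_pow_prime p
    (zetaK_isPrimitiveRoot p)).pow_pow

theorem zetaInt_sub_one_dvd_natCast_iff (T : ℕ) :
    zetaInt p - 1 ∣ (T : 𝓞 (cycField p)) ↔ (T : ZMod p) = 0 := by
  rw [ZMod.natCast_eq_zero_iff, ← Int.natCast_dvd_natCast, ← Int.cast_natCast (R := 𝓞 (cycField p))]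
  exact IsCyclotomicExtension.Rat.zeta_sub_one_dvd_intCast_iff' p (zetaK_isPrimitiveRoot p)

end Val

section Weil

variable (p : ℕ) [hp : Fact p.Prime] (F : Type*) [Field F] [Fintype F] [Algebra (ZMod p) F]

/-- The Weil sum `W_{F,d}(a)` as an algebraic integer of the cyclotomic field. -/
noncomputable abbrev weilInt (d : ℕ) (a : F) : 𝓞 (cycField p) :=
  charSum p F (zetaInt_isPrimitiveRoot p).pow_eq_one d a

theorem weilInt_coe (d : ℕ) (a : F) :
    (weilInt p F d a : cycField p) = ⟨weilSum p F d a, weilSum_mem p F d a⟩ := by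
  refine Subtype.ext ?_
  have h := map_charSum p F
    ((cycField p).val.toRingHom.comp (algebraMap (𝓞 (cycField p)) (cycField p)))
    (zetaInt_isPrimitiveRoot p).pow_eq_one (zeta_isPrimitiveRoot p).pow_eq_one rfl d a
  refine h.trans (Finset.sum_congr rfl fun x _ => ?_)
  rw [traceChar_apply, canonChar, zeta, ← Complex.exp_nat_mul]
  congr 1
  ring

theorem le_minVal_iff (m d : ℕ) :
    (((m : ℚ) / ((p : ℚ) - 1) : ℚ) : WithTop ℚ) ≤ minVal p F d ↔
      ∀ a : F, (zetaInt p - 1) ^ m ∣ weilInt p F d a := by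
  simp [minVal, Finset.le_inf'_iff, ← weilInt_coe, le_val_iff]

theorem minVal_eq_iff (m d : ℕ) :
    minVal p F d = (((m : ℚ) / ((p : ℚ) - 1) : ℚ) : WithTop ℚ) ↔
      (∀ a : F, (zetaInt p - 1) ^ m ∣ weilInt p F d a) ∧
      ¬ ∀ a : F, (zetaInt p - 1) ^ (m + 1) ∣ weilInt p F d a := by
  obtain ⟨a, -, ha⟩ := Finset.exists_mem_eq_inf' Finset.univ_nonempty
    fun a : F => val p ⟨weilSum p F d a, weilSum_mem p F d a⟩
  rw [← le_minVal_iff, ← le_minVal_iff, minVal, ha]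
  exact val_eq_iff p m _

omit [Fintype F] in
theorem finrank_eq_div : (Module.finrank (ZMod p) F : ℚ) =
    ((Module.finrank (ZMod p) F * (p - 1) : ℕ) : ℚ) / ((p : ℚ) - 1) := by
  rw [Nat.cast_mul, Nat.cast_sub hp.out.one_le, Nat.cast_one,
    mul_div_cancel_right₀ _ (natCast_sub_one_pos p).ne']

theorem associated_card :
    Associated ((zetaInt p - 1) ^ (Module.finrank (ZMod p) F * (p - 1)))
      (Fintype.card F : 𝓞 (cycField p)) := by
  rw [card_eq_pow p F]
  exact associated_pow_natCast_pow p _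

/-- If `|F|` divides every Weil sum, then each quotient is an algebraic integer all of whose
conjugates lie in the closed unit disc, so by Kronecker's theorem it is zero or a root of unity.
The sums add up to `|F|`, so one of them has absolute value `|F|`. -/
theorem degenerate_of_forall_card_dvd {d : ℕ} (hd : 0 < d)
    (hcop : d.gcd (Fintype.card F - 1) = 1)
    (h : ∀ a : F, (Fintype.card F : 𝓞 (cycField p)) ∣ weilInt p F d a) : Degenerate p F d := by
  have hq : (Fintype.card F : 𝓞 (cycField p)) ≠ 0 := Nat.cast_ne_zero.2 Fintype.card_ne_zero
  obtain ⟨a, -, ha⟩ : ∃ a ∈ Finset.univ, weilInt p F d a ≠ 0 := by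
    apply Finset.exists_ne_zero_of_sum_ne_zero
    rwa [sum_charSum p F (zetaInt_isPrimitiveRoot p) hd]
  obtain ⟨u, hu⟩ := h a
  have hu0 : (u : cycField p) ≠ 0 := by
    rintro h0
    rw [RingOfIntegers.coe_eq_zero_iff] at h0
    exact ha (by rw [hu, h0, mul_zero])
  have hprim (φ : cycField p →+* ℂ) : IsPrimitiveRoot (φ (zetaK p)) p :=
    (zetaK_isPrimitiveRoot p).map_of_injective φ.injective
  have hφ (φ : cycField p →+* ℂ) :
      charSum p F (hprim φ).pow_eq_one d a = Fintype.card F * φ u := by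
    rw [← map_charSum p F (φ.comp (algebraMap (𝓞 (cycField p)) (cycField p)))
      (zetaInt_isPrimitiveRoot p).pow_eq_one (hprim φ).pow_eq_one rfl d a]
    change φ (weilInt p F d a : cycField p) = _
    rw [hu]
    simp
  have hq' : (0 : ℝ) < Fintype.card F := by exact_mod_cast Fintype.card_pos
  obtain ⟨m, hm, hroot⟩ := Embeddings.pow_eq_one_of_norm_le_one (cycField p) ℂ hu0
    (RingOfIntegers.isIntegral_coe u) fun φ => by
      have h1 := norm_charSum_le p F (hprim φ).pow_eq_one d a
      rw [hφ, norm_mul, Complex.norm_natCast] at h1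
      exact le_of_mul_le_mul_left (h1.trans_eq (mul_one _).symm) hq'
  let φ : cycField p →+* ℂ := (cycField p).val.toRingHom
  refine degenerate_of_norm_charSum p F (hprim φ) hd hcop (a := a) ?_
  rw [hφ, norm_mul, Complex.norm_natCast,
    Complex.norm_eq_one_of_pow_eq_one (by rw [← map_pow, hroot, map_one]) hm.ne', mul_one]

theorem minVal_eq_finrank_of_degenerate {d : ℕ} (hd : 0 < d) (hdeg : Degenerate p F d) :
    minVal p F d = ((Module.finrank (ZMod p) F : ℚ) : WithTop ℚ) := by
  classical
  have hw := charSum_of_degenerate p F (zetaInt_isPrimitiveRoot p) hd hdeg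
  have hassoc := associated_card p F
  rw [finrank_eq_div, minVal_eq_iff]
  refine ⟨fun a => ?_, fun h => ?_⟩
  · rw [weilInt, hw]
    split_ifs
    · exact hassoc.dvd
    · exact dvd_zero _
  · have h1 := h 1
    rw [weilInt, hw, if_pos rfl, ← hassoc.dvd_iff_dvd_right] at h1
    have hprime := (zetaK_isPrimitiveRoot p).zeta_sub_one_prime'
    have := (pow_dvd_pow_iff hprime.ne_zero hprime.not_isUnit).1 h1
    omega

/-- For a nondegenerate exponent `|F|` is divisible by the cube of the prime `ζ - 1`, so only the
leading term of the Weil sum matters modulo this cube. -/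
theorem sq_dvd_weilInt_and_cube_dvd_iff {d : ℕ} (hd : 0 < d)
    (hcop : d.gcd (Fintype.card F - 1) = 1) (hnd : ¬ Degenerate p F d) (a : F) :
    (zetaInt p - 1) ^ 2 ∣ weilInt p F d a ∧
      ((zetaInt p - 1) ^ 3 ∣ weilInt p F d a ↔
        ∑ x : F, Algebra.trace (ZMod p) F (x ^ d) * Algebra.trace (ZMod p) F (-a * x) = 0) := by
  obtain ⟨T, c, e, hT, hw⟩ := exists_charSum_eq p F (zetaInt_isPrimitiveRoot p) hd hcop a
  have hq : (zetaInt p - 1) ^ 3 ∣ (Fintype.card F : 𝓞 (cycField p)) * e :=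
    ((pow_dvd_pow _ (three_le_of_not_degenerate p F hcop hnd)).trans
      (associated_card p F).dvd).mul_right e
  have hne : (zetaInt p - 1) ^ 2 ≠ 0 :=
    pow_ne_zero _ (zetaK_isPrimitiveRoot p).zeta_sub_one_prime'.ne_zero
  rw [weilInt, hw]
  refine ⟨dvd_add (dvd_mul_right _ _) ((pow_dvd_pow _ (by norm_num)).trans hq), ?_⟩
  rw [dvd_add_left hq, pow_succ, mul_dvd_mul_iff_left hne, dvd_add_left (dvd_mul_right _ _),
    zetaInt_sub_one_dvd_natCast_iff, hT]

end Weil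

end BinomialWeil

theorem corollary2p6 (p : ℕ) [Fact p.Prime] (F : Type*) [Field F] [Fintype F]
    [Algebra (ZMod p) F] (d : ℕ) (hd : 0 < d)
    (hcop : Nat.gcd d (Fintype.card F - 1) = 1) :
    (BinomialWeil.minVal p F d = (((Module.finrank (ZMod p) F : ℕ) : ℚ) : WithTop ℚ) ↔
      BinomialWeil.Degenerate p F d) ∧
    (¬ BinomialWeil.Degenerate p F d →
      ((2 / ((p : ℚ) - 1) : ℚ) : WithTop ℚ) ≤ BinomialWeil.minVal p F d ∧
      BinomialWeil.minVal p F d < (((Module.finrank (ZMod p) F : ℕ) : ℚ) : WithTop ℚ) ∧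
      (BinomialWeil.minVal p F d = ((2 / ((p : ℚ) - 1) : ℚ) : WithTop ℚ) ↔
        ∃ k : ℕ, -(d : ℤ) ≡ (p : ℤ) ^ k [ZMOD (Fintype.card F : ℤ) - 1])) := by
  open BinomialWeil in
  have hdeg : ((Module.finrank (ZMod p) F : ℚ) : WithTop ℚ) ≤ minVal p F d →
      Degenerate p F d := by
    rw [finrank_eq_div, le_minVal_iff]
    exact fun h => degenerate_of_forall_card_dvd p F hd hcop fun a =>
      (associated_card p F).symm.dvd.trans (h a)
  refine ⟨⟨fun h => hdeg h.ge, minVal_eq_finrank_of_degenerate p F hd⟩, fun hnd => ?_⟩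
  have hkey := sq_dvd_weilInt_and_cube_dvd_iff p F hd hcop hnd
  have hsq := fun a => (hkey a).1
  rw [← Nat.cast_ofNat (R := ℚ)]
  refine ⟨(le_minVal_iff p F 2 d).2 hsq, not_le.1 fun h => hnd (hdeg h), ?_⟩
  rw [minVal_eq_iff, and_iff_right hsq, forall_congr' fun a => (hkey a).2,
    ← not_iff_not, not_not, ← forall_sum_trace_mul_trace_eq_zero_iff p F hcop]
  exact (neg_surjective.forall (p := fun a : F => ∑ x : F,
    Algebra.trace (ZMod p) F (x ^ d) * Algebra.trace (ZMod p) F (a * x) = 0)).symm
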